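/- Let $x=(x_1,x_{-1})$ be real time variables ranging over an open set $X\subseteq\mathbb{R}^2$, write $\partial_1,\partial_{-1}$ for the partial derivatives with respect to $x_1,x_{-1}$, and let $n\in\mathbb{Z}$. For nonzero $k,k'\in\mathbb{C}$ put $$\rho_n(k)=e^{kx_1+k^{-1}x_{-1}}k^n,\qquad \sigma_n(k')=e^{k'x_1+k'^{-1}x_{-1}}(-k')^{-n},\qquad \Omega(k,k')=\frac{1}{k+k'},$$ and let $\boldsymbol{c}(k)=(k^i)_{i\in\mathbb{Z}}$. Let $D\subseteq\mathbb{C}\times\mathbb{C}$ be a measurable integration domain with an arbitrary complex measure $\mathrm{d}\zeta=w\,\mathrm{d}\mu$ ($\mu$ a positive measure, $w$ a measurable complex density), and let $S\subseteq\mathbb{C}\setminus\{0\}$ be a set of spectral parameters such that $l\neq0$ and $l'\in S$ for all $(l,l')\in D$, and such that, for each $k'\in S$, $l+k'\ne 0$ for $\mu$-almost every $(l,l')\in D$. Consider the adjoint linear integral equation for an infinite row vector ${}^{t}\boldsymbol{v}_n(k')$ with components indexed by $\mathbb{Z}$, $${}^{t}\boldsymbol{v}_n(k')+\iint_D\mathrm{d}\zeta(l,l')\,\rho_n(l)\Omega(l,k')\sigma_n(k')\,{}^{t}\boldsymbol{v}_n(l')={}^{t}\boldsymbol{c}(k')\,\sigma_n(k'),\qquad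 n\in\mathbb{Z},\ x\in X,\ k'\in S .$$ Assume that for all $n\in\mathbb{Z}$ and $x\in X$ the corresponding homogeneous equation $f(k')+\iint_D\mathrm{d}\zeta(l,l')\,\rho_n(l)\Omega(l,k')\sigma_n(k')f(l')=0$ ($k'\in S$) has only the zero solution on $S$, among scalar functions $f$ for which this integral and the integrals $\iint_D\mathrm{d}\zeta(k,k')\,\rho_n(k)\boldsymbol{c}(k)f(k')$ converge absolutely. Let ${}^{t}\boldsymbol{v}_n(k')$ be any solution of the adjoint equation for which the integral in the equation and the integral $$\boldsymbol{U}_n=\iint_D\mathrm{d}\zeta(k,k')\,\rho_n(k)\,\boldsymbol{c}(k)\,{}^{t}\boldsymbol{v}_n(k')$$ are entrywise absolutely convergent and can be differentiated once in $x$ under the integral sign (integrands differentiable in $x$, and dominated together with their derivative by an integrable function, locally uniformly in $x$). Then: (i) $1-\boldsymbol{U}_n^{(0,-1)}$ has no zero in $X$, for every $n$; hence on every simply connected open set $Y\subseteq X$ there are continuous branches $\varphi_n=\ln\bigl(1-\boldsymbol{U}_n^{(0,-1)}\bigr)$, $n\in\mathbb{Z}$. (ii) For every open $Y\subseteq X$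 and every choice of continuous branches $\varphi_n=\ln\bigl(1-\boldsymbol{U}_n^{(0,-1)}\bigr)$ on $Y$, $n\in\mathbb{Z}$, the functions $\varphi_n$ are $C^2$ and solve the two-dimensional Toda equation of $A_\infty$-type on $Y$, $$\partial_1\partial_{-1}\varphi_n=e^{\varphi_n-\varphi_{n-1}}-e^{\varphi_{n+1}-\varphi_n},\qquad n\in\mathbb{Z}.$$ (iii) For such $Y$ and $\varphi_n$ and every $k'\in S$, the adjoint wave function $\psi_n=[{}^{t}\boldsymbol{v}_n(k')]^{(0)}$ (the $0$th component), collected into the infinite column vector $\Psi=(\psi_i)_{i\in\mathbb{Z}}$, satisfies on $Y$ the adjoint Lax pair $$\partial_1\Psi=\boldsymbol{P}'\Psi,\qquad \partial_{-1}\Psi=\boldsymbol{Q}'\Psi,$$ where the nonzero entries of the infinite matrices are $\boldsymbol{P}'_{i,i}=-\partial_1\varphi_{i-1}$, $\boldsymbol{P}'_{i,i-1}=-1$ and $\boldsymbol{Q}'_{i,i+1}=-e^{-\theta_i}$ with $\theta_i=\varphi_{i-1}-\varphi_i$; that is, $\partial_1\psi_n=-(\partial_1\varphi_{n-1})\psi_n-\psi_{n-1}$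 and $\partial_{-1}\psi_n=-e^{\varphi_n-\varphi_{n-1}}\psi_{n+1}$. -/

import Mathlib

open MeasureTheory Topology

noncomputable section

namespace TodaDL

/-! The two times are a point `x : ℝ × ℝ`, with `x.1` the time `x₁` and `x.2` the time `x₋₁`.
A point `p : ℂ × ℂ` of the integration domain is `(l, l')`. The complex integration measure
`dζ` on a domain `D ⊆ ℂ × ℂ` is given by a positive measure `μ` and a complex density `w`,
that is `dζ = w dμ` on `D`. -/

/-- Plane wave factor `ρ_n(k) = exp(k x₁ + k⁻¹ x₋₁) k ^ n`. -/
def rho (n : ℤ) (x : ℝ × ℝ) (k : ℂ) : ℂ :=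
  Complex.exp (k * (x.1 : ℂ) + k⁻¹ * (x.2 : ℂ)) * k ^ n

/-- Plane wave factor `σ_n(k') = exp(k' x₁ + k'⁻¹ x₋₁) (-k') ^ (-n)`. -/
def sigma (n : ℤ) (x : ℝ × ℝ) (k' : ℂ) : ℂ :=
  Complex.exp (k' * (x.1 : ℂ) + k'⁻¹ * (x.2 : ℂ)) * (-k') ^ (-n)

/-- Cauchy kernel `Ω(k, k') = 1 / (k + k')`. -/
def Omega (k k' : ℂ) : ℂ := 1 / (k + k')

/-- The infinite vector `c(k)` of all integer powers of `k`. -/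
def cvec (k : ℂ) : ℤ → ℂ := fun i => k ^ i

/-- For a scalar function `f` of the spectral parameter, the integrand (at the point
`p = (l, l')`) of `∬_D dζ(l,l') ρ_n(l) Ω(l,k') σ_n(k') f(l')`. -/
def adjIntegrand (w : ℂ × ℂ → ℂ) (n : ℤ) (x : ℝ × ℝ) (k' : ℂ) (f : ℂ → ℂ) (p : ℂ × ℂ) : ℂ :=
  w p * (rho n x p.1 * Omega p.1 k' * sigma n x k' * f p.2)

/-- For a scalar function `f` of the spectral parameter, the integrand (at the point
`p = (k, k')`) of the `i`-th component of `∬_D dζ(k,k') ρ_n(k) c(k) f(k')`. -/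
def potIntegrand (w : ℂ × ℂ → ℂ) (n : ℤ) (x : ℝ × ℝ) (i : ℤ) (f : ℂ → ℂ) (p : ℂ × ℂ) : ℂ :=
  w p * (rho n x p.1 * cvec p.1 i * f p.2)

/-- At fixed `n` and `x`, the homogeneous adjoint equation
`f(k') + ∬_D dζ(l,l') ρ_n(l) Ω(l,k') σ_n(k') f(l') = 0` (`k' ∈ S`) has only the zero solution,
among all `f` for which the integral of the equation and the integrals
`∬_D dζ(k,k') ρ_n(k) c(k) f(k')` converge absolutely. -/
def HomogeneousOnlyZero (μ : Measure (ℂ × ℂ)) (w : ℂ × ℂ → ℂ) (D : Set (ℂ × ℂ)) (S : Set ℂ)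
    (n : ℤ) (x : ℝ × ℝ) : Prop :=
  ∀ f : ℂ → ℂ,
    (∀ k' ∈ S, IntegrableOn (adjIntegrand w n x k' f) D μ) →
    (∀ i : ℤ, IntegrableOn (potIntegrand w n x i f) D μ) →
    (∀ k' ∈ S, f k' + ∫ p in D, adjIntegrand w n x k' f p ∂μ = 0) →
    ∀ k' ∈ S, f k' = 0

/-- The integral `∫ F x p dν(p)` converges absolutely and may be differentiated once in `x ∈ X`
under the integral sign: `F` is measurable in `p`, differentiable in `x`, and `F` and its
`x`-derivative are dominated by an integrable function, locally uniformly in `x`. -/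
structure RegularIntegrand (ν : Measure (ℂ × ℂ)) (X : Set (ℝ × ℝ))
    (F : ℝ × ℝ → ℂ × ℂ → ℂ) : Prop where
  measurable : ∀ x ∈ X, AEStronglyMeasurable (F x) ν
  differentiable : ∀ᵐ p ∂ν, DifferentiableOn ℝ (fun x => F x p) X
  dominated : ∀ x ∈ X, ∃ N ∈ 𝓝 x, ∃ g : ℂ × ℂ → ℝ, Integrable g ν ∧
    ∀ᵐ p ∂ν, ∀ y ∈ N ∩ X, ‖F y p‖ ≤ g p ∧ ‖fderiv ℝ (fun z => F z p) y‖ ≤ g p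

/-- `v n x k' j` is the `j`-th component of the row vector `ᵗv_n(k')` at the times `x`.
It solves, for all `n`, all `x ∈ X` and all `k' ∈ S`, the adjoint linear integral equation
`ᵗv_n(k') + ∬_D dζ(l,l') ρ_n(l) Ω(l,k') σ_n(k') ᵗv_n(l') = ᵗc(k') σ_n(k')`,
where the integral of the equation and those of
`∬_D dζ(k,k') ρ_n(k) c(k) ᵗv_n(k')` converge and may be differentiated in `x`. -/
structure IsAdjointSolution (μ : Measure (ℂ × ℂ)) (w : ℂ × ℂ → ℂ) (D : Set (ℂ × ℂ)) (S : Set ℂ)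
    (X : Set (ℝ × ℝ)) (v : ℤ → ℝ × ℝ → ℂ → ℤ → ℂ) : Prop where
  regular_eq : ∀ n j : ℤ, ∀ k' ∈ S, RegularIntegrand (μ.restrict D) X
    (fun x => adjIntegrand w n x k' (fun l' => v n x l' j))
  regular_pot : ∀ n i j : ℤ, RegularIntegrand (μ.restrict D) X
    (fun x => potIntegrand w n x i (fun l' => v n x l' j))
  equation : ∀ n j : ℤ, ∀ x ∈ X, ∀ k' ∈ S,
    v n x k' j + ∫ p in D, adjIntegrand w n x k' (fun l' => v n x l' j) p ∂μ
      = cvec k' j * sigma n x k'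

/-- The infinite matrix `U_n = ∬_D dζ(k,k') ρ_n(k) c(k) ᵗv_n(k')`. -/
def Umat (μ : Measure (ℂ × ℂ)) (w : ℂ × ℂ → ℂ) (D : Set (ℂ × ℂ))
    (v : ℤ → ℝ × ℝ → ℂ → ℤ → ℂ) (n : ℤ) (x : ℝ × ℝ) : Matrix ℤ ℤ ℂ :=
  fun i j => ∫ p in D, potIntegrand w n x i (fun k' => v n x k' j) p ∂μ

/-- Partial derivative with respect to `x₁`. -/
def d1 (f : ℝ × ℝ → ℂ) (x : ℝ × ℝ) : ℂ := deriv (fun s : ℝ => f (s, x.2)) x.1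

/-- Partial derivative with respect to `x₋₁`. -/
def dm1 (f : ℝ × ℝ → ℂ) (x : ℝ × ℝ) : ℂ := deriv (fun s : ℝ => f (x.1, s)) x.2

/-- On `Y`, `φ n` is a continuous branch of the logarithm of `a n`, for every `n`. -/
def IsLogBranch (a φ : ℤ → ℝ × ℝ → ℂ) (Y : Set (ℝ × ℝ)) : Prop :=
  ∀ n : ℤ, ContinuousOn (φ n) Y ∧ ∀ x ∈ Y, Complex.exp (φ n x) = a n x

/-- `φ` is a classical solution on `Y` of
`∂₁∂₋₁φ_n = exp(φ_n - φ_{n-1}) - exp(φ_{n+1} - φ_n)`. -/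
def SolvesToda (φ : ℤ → ℝ × ℝ → ℂ) (Y : Set (ℝ × ℝ)) : Prop :=
  ∀ n : ℤ, ContDiffOn ℝ 2 (φ n) Y ∧ ∀ x ∈ Y,
    d1 (dm1 (φ n)) x
      = Complex.exp (φ n x - φ (n - 1) x) - Complex.exp (φ (n + 1) x - φ n x)

/-- Product of an infinite matrix and an infinite vector. -/
def infMulVec (M : Matrix ℤ ℤ ℂ) (u : ℤ → ℂ) : ℤ → ℂ := fun i => ∑' j : ℤ, M i j * u j

/-- The quantity `θ_n = φ_{n-1} - φ_n`. -/
def theta (φ : ℤ → ℝ × ℝ → ℂ) (n : ℤ) (x : ℝ × ℝ) : ℂ := φ (n - 1) x - φ n x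

/-- The matrix `P'`: diagonal entries `-∂₁φ_{i-1}`, subdiagonal entries `-1`. -/
def Pmat' (φ : ℤ → ℝ × ℝ → ℂ) (x : ℝ × ℝ) : Matrix ℤ ℤ ℂ := fun i j =>
  if j = i then -d1 (φ (i - 1)) x else if j = i - 1 then -1 else 0

/-- The matrix `Q'`: superdiagonal entries `-exp(-θ_i)`. -/
def Qmat' (φ : ℤ → ℝ × ℝ → ℂ) (x : ℝ × ℝ) : Matrix ℤ ℤ ℂ := fun i j =>
  if j = i + 1 then -Complex.exp (-theta φ i x) else 0

/-- The infinite vector `Ψ = (ψ_i)` has, on `Y`, partial derivatives satisfying the adjoint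
Lax pair `∂₁Ψ = P'Ψ`, `∂₋₁Ψ = Q'Ψ`. -/
def SolvesAdjointLax (φ ψ : ℤ → ℝ × ℝ → ℂ) (Y : Set (ℝ × ℝ)) : Prop :=
  ∀ x ∈ Y, ∀ i : ℤ,
    HasDerivAt (fun s : ℝ => ψ i (s, x.2)) (infMulVec (Pmat' φ x) (fun j => ψ j x) i) x.1 ∧
    HasDerivAt (fun s : ℝ => ψ i (x.1, s)) (infMulVec (Qmat' φ x) (fun j => ψ j x) i) x.2

end TodaDL

end

open TodaDL

/-! Uniqueness drives everything: two admissible solutions of the adjoint equation with the same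
right-hand side agree on `S` (`EquationSolution.unique`). Raising `n` or differentiating in `x`
changes the kernel by a term with a factor `l + k'`, which cancels `Ω(l, k')` and leaves separated
products. Hence `v n` solves the equation at level `n + 1`, and its derivative solves the one at
level `n`, with right-hand sides that are combinations of the `k ^ j σ`. Uniqueness turns this into
the linear relations `wave_shift` and `fderiv_wave`.

Integrating these against `ρ c` gives `Umat_shift` and the closed quadratic system `fderiv_Umat`,
which also makes `U` smooth. The shift relation contains `(1 - U_n^(0,-1)) (1 - U_{n+1}^(-1,0)) =
1`, hence the nonvanishing. The logarithmic derivatives of `1 - U_n^(0,-1)` are the differences in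
`n` of `U^(0,0)` and `U^(-1,-1)`, and `∂₁ U_n^(-1,-1) = 1 - (1 - U_n^(0,-1)) (1 - U_n^(-1,0)) = 1 -
exp(φ_n - φ_{n-1})`; differencing in `n` gives Toda. The Lax pair combines the same formulas with
`wave_shift`. -/

namespace TodaDL

/-! ### Differentiation under the integral sign. -/

section Integrals

variable {ν : Measure (ℂ × ℂ)} {X : Set (ℝ × ℝ)} {F : ℝ × ℝ → ℂ × ℂ → ℂ}

theorem RegularIntegrand.integrable (hF : RegularIntegrand ν X F) {x : ℝ × ℝ} (hx : x ∈ X) :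
    Integrable (F x) ν := by
  obtain ⟨N, hN, g, hg, hb⟩ := hF.dominated x hx
  exact hg.mono' (hF.measurable x hx) (hb.mono fun p hp => (hp x ⟨mem_of_mem_nhds hN, hx⟩).1)

theorem RegularIntegrand.aestronglyMeasurable_fderiv_apply (hF : RegularIntegrand ν X F)
    (hX : IsOpen X) {x : ℝ × ℝ} (hx : x ∈ X) (e : ℝ × ℝ) :
    AEStronglyMeasurable (fun p => fderiv ℝ (fun z => F z p) x e) ν := by
  have ht : Filter.Tendsto (fun m : ℕ => ((m : ℝ) + 1)) Filter.atTop Filter.atTop :=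
    Filter.tendsto_atTop_add_const_right _ _ tendsto_natCast_atTop_atTop
  have hxt : Filter.Tendsto (fun m : ℕ => x + ((m : ℝ) + 1)⁻¹ • e) Filter.atTop (𝓝 x) := by
    simpa using (ht.inv_tendsto_atTop.smul_const e).const_add x
  -- Measurability is known only at times in `X`, so the difference quotients start at an index
  -- after which `x + e / (m + 1)` stays in `X`.
  obtain ⟨m₀, hm₀⟩ := Filter.eventually_atTop.1 (hxt.eventually (hX.mem_nhds hx))
  refine aestronglyMeasurable_of_tendsto_ae (u := Filter.atTop)
    (f := fun (m : ℕ) p => (((m + m₀ : ℕ) : ℝ) + 1) •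
      (F (x + (((m + m₀ : ℕ) : ℝ) + 1)⁻¹ • e) p - F x p)) (fun m => ?_) ?_
  · exact ((hF.measurable _ (hm₀ _ (Nat.le_add_left _ _))).sub
      (hF.measurable x hx)).const_smul (((m + m₀ : ℕ) : ℝ) + 1)
  · filter_upwards [hF.differentiable] with p hp
    have hd := (hp.differentiableAt (hX.mem_nhds hx)).hasFDerivAt
    exact (hd.lim e (tendsto_norm_atTop_atTop.comp ht)).comp
      (Filter.tendsto_add_atTop_nat m₀)

/-- A linear map on `ℝ × ℝ` is rebuilt continuously from its values on the two basis vectors, so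
directional measurability suffices. -/
theorem RegularIntegrand.aestronglyMeasurable_fderiv (hF : RegularIntegrand ν X F)
    (hX : IsOpen X) {x : ℝ × ℝ} (hx : x ∈ X) :
    AEStronglyMeasurable (fun p => fderiv ℝ (fun z => F z p) x) ν := by
  have h1 := (ContinuousLinearMap.smulRightL ℝ (ℝ × ℝ) ℂ
    (ContinuousLinearMap.fst ℝ ℝ ℝ)).continuous.comp_aestronglyMeasurable
      (hF.aestronglyMeasurable_fderiv_apply hX hx (1, 0))
  have h2 := (ContinuousLinearMap.smulRightL ℝ (ℝ × ℝ) ℂ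
    (ContinuousLinearMap.snd ℝ ℝ ℝ)).continuous.comp_aestronglyMeasurable
      (hF.aestronglyMeasurable_fderiv_apply hX hx (0, 1))
  refine (h1.add h2).congr (Filter.Eventually.of_forall fun p => ?_)
  refine ContinuousLinearMap.ext fun y => ?_
  have hy : y = y.1 • ((1, 0) : ℝ × ℝ) + y.2 • ((0, 1) : ℝ × ℝ) := by ext <;> simp
  conv_rhs => rw [hy, map_add, map_smul, map_smul]
  simp

theorem RegularIntegrand.integrable_fderiv (hF : RegularIntegrand ν X F)
    (hX : IsOpen X) {x : ℝ × ℝ} (hx : x ∈ X) :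
    Integrable (fun p => fderiv ℝ (fun z => F z p) x) ν := by
  obtain ⟨N, hN, g, hg, hb⟩ := hF.dominated x hx
  exact hg.mono' (hF.aestronglyMeasurable_fderiv hX hx)
    (hb.mono fun p hp => (hp x ⟨mem_of_mem_nhds hN, hx⟩).2)

theorem RegularIntegrand.hasFDerivAt_integral (hF : RegularIntegrand ν X F)
    (hX : IsOpen X) {x : ℝ × ℝ} (hx : x ∈ X) :
    HasFDerivAt (fun z => ∫ p, F z p ∂ν) (∫ p, fderiv ℝ (fun z => F z p) x ∂ν) x := by
  obtain ⟨N, hN, g, hg, hb⟩ := hF.dominated x hx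
  refine hasFDerivAt_integral_of_dominated_of_fderiv_le (𝕜 := ℝ) (s := N ∩ X) (bound := g)
    (F' := fun x p => fderiv ℝ (fun z => F z p) x)
    (Filter.inter_mem hN (hX.mem_nhds hx)) ?_ (hF.integrable hx)
    (hF.aestronglyMeasurable_fderiv hX hx) ?_ hg ?_
  · filter_upwards [hX.mem_nhds hx] with y hy using hF.measurable y hy
  · exact hb.mono fun p hp y hy => (hp y hy).2
  · filter_upwards [hF.differentiable] with p hp y hy
    exact (hp.differentiableAt (hX.mem_nhds hy.2)).hasFDerivAt

theorem RegularIntegrand.fderiv_integral_apply (hF : RegularIntegrand ν X F)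
    (hX : IsOpen X) {x : ℝ × ℝ} (hx : x ∈ X) (e : ℝ × ℝ) :
    fderiv ℝ (fun z => ∫ p, F z p ∂ν) x e = ∫ p, fderiv ℝ (fun z => F z p) x e ∂ν := by
  rw [(hF.hasFDerivAt_integral hX hx).fderiv,
    ContinuousLinearMap.integral_apply (hF.integrable_fderiv hX hx)]

end Integrals

/-! ### Dispersion and shift relations of the plane waves. -/

section PlaneWaves

/-- The logarithmic derivative of the plane waves in the direction `e`. -/
noncomputable def phase (e : ℝ × ℝ) (k : ℂ) : ℂ := k * (e.1 : ℂ) + k⁻¹ * (e.2 : ℂ)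

theorem hasFDerivAt_phase (k : ℂ) (x : ℝ × ℝ) :
    ∃ L : ℝ × ℝ →L[ℝ] ℂ, HasFDerivAt (fun z => phase z k) L x ∧ ∀ e, L e = phase e k := by
  refine ⟨k • (Complex.ofRealCLM.comp (ContinuousLinearMap.fst ℝ ℝ ℝ)) +
    k⁻¹ • (Complex.ofRealCLM.comp (ContinuousLinearMap.snd ℝ ℝ ℝ)), ?_, fun e => by simp [phase]⟩
  exact (((Complex.ofRealCLM.comp (ContinuousLinearMap.fst ℝ ℝ ℝ)).hasFDerivAt).const_mul k).add
    (((Complex.ofRealCLM.comp (ContinuousLinearMap.snd ℝ ℝ ℝ)).hasFDerivAt).const_mul k⁻¹)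

theorem hasFDerivAt_rho (n : ℤ) (k : ℂ) (x : ℝ × ℝ) :
    ∃ L : ℝ × ℝ →L[ℝ] ℂ, HasFDerivAt (fun z => rho n z k) L x ∧
      ∀ e, L e = phase e k * rho n x k := by
  obtain ⟨L, hL, hLe⟩ := hasFDerivAt_phase k x
  refine ⟨_, (hL.cexp).mul_const (k ^ n), fun e => ?_⟩
  simp [hLe, rho, phase]
  ring

theorem hasFDerivAt_sigma (n : ℤ) (k : ℂ) (x : ℝ × ℝ) :
    ∃ L : ℝ × ℝ →L[ℝ] ℂ, HasFDerivAt (fun z => sigma n z k) L x ∧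
      ∀ e, L e = phase e k * sigma n x k := by
  obtain ⟨L, hL, hLe⟩ := hasFDerivAt_phase k x
  refine ⟨_, (hL.cexp).mul_const ((-k) ^ (-n)), fun e => ?_⟩
  simp [hLe, sigma, phase]
  ring

theorem sigma_eq_neg_mul_sigma_succ (n : ℤ) (x : ℝ × ℝ) {k : ℂ} (hk : k ≠ 0) :
    sigma n x k = -k * sigma (n + 1) x k := by
  have h : (-k) ^ (-n) = -k * (-k) ^ (-(n + 1)) := by
    rw [← zpow_one_add₀ (neg_ne_zero.2 hk)]; congr 1; ring
  simp only [sigma, h]; ring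

theorem rho_succ (n : ℤ) (x : ℝ × ℝ) {k : ℂ} (hk : k ≠ 0) :
    rho (n + 1) x k = k * rho n x k := by
  simp only [rho, zpow_add_one₀ hk]; ring

end PlaneWaves

/-! ### Linearity, uniqueness and level shift for the adjoint equation. -/

section Equation

variable {μ : Measure (ℂ × ℂ)} {w : ℂ × ℂ → ℂ} {D : Set (ℂ × ℂ)} {S : Set ℂ}

/-- `f` solves on `S` the adjoint equation with right-hand side `r`, with absolutely convergent
integrals. -/
structure EquationSolution (μ : Measure (ℂ × ℂ)) (w : ℂ × ℂ → ℂ) (D : Set (ℂ × ℂ)) (S : Set ℂ)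
    (n : ℤ) (x : ℝ × ℝ) (f r : ℂ → ℂ) : Prop where
  integrable_adj : ∀ k' ∈ S, IntegrableOn (adjIntegrand w n x k' f) D μ
  integrable_pot : ∀ i : ℤ, IntegrableOn (potIntegrand w n x i f) D μ
  equation : ∀ k' ∈ S, f k' + ∫ p in D, adjIntegrand w n x k' f p ∂μ = r k'

/-- The `i`-th component of `∬_D dζ(k,k') ρ_n(k) c(k) f(k')`. -/
noncomputable def potential (μ : Measure (ℂ × ℂ)) (w : ℂ × ℂ → ℂ) (D : Set (ℂ × ℂ)) (n : ℤ)
    (x : ℝ × ℝ) (i : ℤ) (f : ℂ → ℂ) : ℂ := ∫ p in D, potIntegrand w n x i f p ∂μ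

theorem adjIntegrand_add (n : ℤ) (x : ℝ × ℝ) (k' : ℂ) (f g : ℂ → ℂ) :
    adjIntegrand w n x k' (fun k => f k + g k)
      = fun p => adjIntegrand w n x k' f p + adjIntegrand w n x k' g p := by
  funext p; simp only [adjIntegrand]; ring

theorem potIntegrand_add (n : ℤ) (x : ℝ × ℝ) (i : ℤ) (f g : ℂ → ℂ) :
    potIntegrand w n x i (fun k => f k + g k)
      = fun p => potIntegrand w n x i f p + potIntegrand w n x i g p := by
  funext p; simp only [potIntegrand]; ring

theorem adjIntegrand_const_mul (n : ℤ) (x : ℝ × ℝ) (k' a : ℂ) (f : ℂ → ℂ) :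
    adjIntegrand w n x k' (fun k => a * f k) = fun p => a * adjIntegrand w n x k' f p := by
  funext p; simp only [adjIntegrand]; ring

theorem potIntegrand_const_mul (n : ℤ) (x : ℝ × ℝ) (i : ℤ) (a : ℂ) (f : ℂ → ℂ) :
    potIntegrand w n x i (fun k => a * f k) = fun p => a * potIntegrand w n x i f p := by
  funext p; simp only [potIntegrand]; ring

variable {n : ℤ} {x : ℝ × ℝ} {f g r s : ℂ → ℂ}

theorem EquationSolution.add (hf : EquationSolution μ w D S n x f r)
    (hg : EquationSolution μ w D S n x g s) :
    EquationSolution μ w D S n x (fun k => f k + g k) (fun k => r k + s k) where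
  integrable_adj k' hk := by
    rw [adjIntegrand_add]; exact (hf.integrable_adj k' hk).add (hg.integrable_adj k' hk)
  integrable_pot i := by
    rw [potIntegrand_add]; exact (hf.integrable_pot i).add (hg.integrable_pot i)
  equation k' hk := by
    rw [adjIntegrand_add, integral_add (hf.integrable_adj k' hk) (hg.integrable_adj k' hk),
      ← hf.equation k' hk, ← hg.equation k' hk]
    ring

theorem EquationSolution.const_mul (hf : EquationSolution μ w D S n x f r) (a : ℂ) :
    EquationSolution μ w D S n x (fun k => a * f k) (fun k => a * r k) where
  integrable_adj k' hk := by
    rw [adjIntegrand_const_mul]; exact (hf.integrable_adj k' hk).const_mul a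
  integrable_pot i := by
    rw [potIntegrand_const_mul]; exact (hf.integrable_pot i).const_mul a
  equation k' hk := by
    rw [adjIntegrand_const_mul, integral_const_mul, ← hf.equation k' hk]
    ring

theorem EquationSolution.congr_rhs (hf : EquationSolution μ w D S n x f r)
    (h : ∀ k' ∈ S, r k' = s k') : EquationSolution μ w D S n x f s :=
  ⟨hf.integrable_adj, hf.integrable_pot, fun k' hk => (hf.equation k' hk).trans (h k' hk)⟩

theorem EquationSolution.unique (huniq : HomogeneousOnlyZero μ w D S n x)
    (hf : EquationSolution μ w D S n x f r) (hg : EquationSolution μ w D S n x g r) :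
    ∀ k' ∈ S, f k' = g k' := fun k' hk => by
  have h := (hf.add (hg.const_mul (-1))).congr_rhs (s := fun _ => 0) fun k _ => by ring
  have := huniq _ h.integrable_adj h.integrable_pot h.equation k' hk
  linear_combination this

theorem potential_add (hf : EquationSolution μ w D S n x f r)
    (hg : EquationSolution μ w D S n x g s) (i : ℤ) :
    potential μ w D n x i (fun k => f k + g k)
      = potential μ w D n x i f + potential μ w D n x i g := by
  rw [potential, potIntegrand_add, integral_add (hf.integrable_pot i) (hg.integrable_pot i)]
  rfl

theorem potential_const_mul (a : ℂ) (f : ℂ → ℂ) (i : ℤ) :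
    potential μ w D n x i (fun k => a * f k) = a * potential μ w D n x i f := by
  rw [potential, potIntegrand_const_mul, integral_const_mul]
  rfl

theorem potential_congr (hD : MeasurableSet D) (hDS : ∀ p ∈ D, p.1 ≠ 0 ∧ p.2 ∈ S)
    (h : ∀ k' ∈ S, f k' = g k') (n : ℤ) (x : ℝ × ℝ) (i : ℤ) :
    potential μ w D n x i f = potential μ w D n x i g :=
  setIntegral_congr_fun hD fun p hp => by
    simp only [potIntegrand, h p.2 (hDS p hp).2]

theorem potIntegrand_succ (i : ℤ) (f : ℂ → ℂ) {p : ℂ × ℂ} (hp : p.1 ≠ 0) :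
    potIntegrand w (n + 1) x i f p = potIntegrand w n x (i + 1) f p := by
  simp only [potIntegrand, rho_succ n x hp, cvec, zpow_add_one₀ hp]; ring

theorem potential_succ (hD : MeasurableSet D) (hDS : ∀ p ∈ D, p.1 ≠ 0 ∧ p.2 ∈ S) (i : ℤ)
    (f : ℂ → ℂ) : potential μ w D (n + 1) x i f = potential μ w D n x (i + 1) f :=
  setIntegral_congr_fun hD fun p hp => potIntegrand_succ i f (hDS p hp).1

/-- Since `ρ_{n+1} = l ρ_n` and `σ_n = -k' σ_{n+1}`, the kernels at levels `n + 1` and `n` differ by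
`(l + k') Ω ρ_n σ_{n+1} = ρ_n σ_{n+1}`, whose integral against `f` is a potential times `σ_{n+1}`.
-/
theorem EquationSolution.succ (hD : MeasurableSet D) (hDS : ∀ p ∈ D, p.1 ≠ 0 ∧ p.2 ∈ S)
    (hS0 : ∀ k' ∈ S, k' ≠ 0) (hSD : ∀ k' ∈ S, ∀ᵐ p ∂(μ.restrict D), p.1 + k' ≠ 0)
    (hf : EquationSolution μ w D S n x f r) :
    EquationSolution μ w D S (n + 1) x f
      (fun k' => r k' + potential μ w D n x 0 f * sigma (n + 1) x k') := by
  have key : ∀ k' ∈ S, (fun p => adjIntegrand w n x k' f p +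
      sigma (n + 1) x k' * potIntegrand w n x 0 f p)
        =ᵐ[μ.restrict D] adjIntegrand w (n + 1) x k' f := by
    intro k' hk
    filter_upwards [hSD k' hk, ae_restrict_mem hD] with p hp hpD
    have h0 := (hDS p hpD).1
    simp only [adjIntegrand, potIntegrand, cvec, Omega, zpow_zero,
      sigma_eq_neg_mul_sigma_succ n x (hS0 k' hk), rho_succ n x h0]
    field_simp
    ring
  refine ⟨fun k' hk => ?_, fun i => ?_, fun k' hk => ?_⟩
  · exact ((hf.integrable_adj k' hk).add
      ((hf.integrable_pot 0).const_mul (sigma (n + 1) x k'))).congr (key k' hk)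
  · exact (hf.integrable_pot (i + 1)).congr
      ((ae_restrict_mem hD).mono fun p hp => (potIntegrand_succ i f (hDS p hp).1).symm)
  · rw [← integral_congr_ae (key k' hk), integral_add (hf.integrable_adj k' hk)
      ((hf.integrable_pot 0).const_mul _), integral_const_mul, ← hf.equation k' hk, potential]
    ring

end Equation

/-! ### Shift and differential relations for the wave vector and the potential matrix. -/

section Solution

/-- A regular solution `v` of the adjoint equation on the open set `X` of times, where the
homogeneous equation has only the zero solution. -/
structure IsUniqueAdjointSolution (μ : Measure (ℂ × ℂ)) (w : ℂ × ℂ → ℂ) (D : Set (ℂ × ℂ))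
    (S : Set ℂ) (X : Set (ℝ × ℝ)) (v : ℤ → ℝ × ℝ → ℂ → ℤ → ℂ) : Prop
    extends IsAdjointSolution μ w D S X v where
  measurableSet : MeasurableSet D
  domain : ∀ p ∈ D, p.1 ≠ 0 ∧ p.2 ∈ S
  ne_zero : ∀ k' ∈ S, k' ≠ 0
  ae_add_ne_zero : ∀ k' ∈ S, ∀ᵐ p ∂(μ.restrict D), p.1 + k' ≠ 0
  isOpen : IsOpen X
  onlyZero : ∀ n : ℤ, ∀ x ∈ X, HomogeneousOnlyZero μ w D S n x

variable {μ : Measure (ℂ × ℂ)} {w : ℂ × ℂ → ℂ} {D : Set (ℂ × ℂ)} {S : Set ℂ}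
  {X : Set (ℝ × ℝ)} {v : ℤ → ℝ × ℝ → ℂ → ℤ → ℂ}

theorem Umat_eq_potential (n : ℤ) (x : ℝ × ℝ) (i j : ℤ) :
    Umat μ w D v n x i j = potential μ w D n x i (fun k => v n x k j) := rfl

namespace IsUniqueAdjointSolution

theorem equationSolution (H : IsUniqueAdjointSolution μ w D S X v) (n j : ℤ) {x : ℝ × ℝ}
    (hx : x ∈ X) :
    EquationSolution μ w D S n x (fun k => v n x k j) (fun k => k ^ j * sigma n x k) :=
  ⟨fun k' hk => (H.regular_eq n j k' hk).integrable hx,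
    fun i => (H.regular_pot n i j).integrable hx, fun k' hk => H.equation n j x hx k' hk⟩

/-- At level `n + 1` the source of `v n` is `U_n^(0,j) σ_{n+1} - k ^ (j+1) σ_{n+1}`, the same
combination of the sources of components `0` and `j + 1`. -/
theorem wave_shift (H : IsUniqueAdjointSolution μ w D S X v) (n j : ℤ) {x : ℝ × ℝ}
    (hx : x ∈ X) {k' : ℂ} (hk : k' ∈ S) :
    v n x k' j = Umat μ w D v n x 0 j * v (n + 1) x k' 0 - v (n + 1) x k' (j + 1) := by
  have h1 := (H.equationSolution n j hx).succ H.measurableSet H.domain H.ne_zero H.ae_add_ne_zero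
  have h2 := ((H.equationSolution (n + 1) 0 hx).const_mul (Umat μ w D v n x 0 j)).add
    ((H.equationSolution (n + 1) (j + 1) hx).const_mul (-1))
  have := h1.unique (H.onlyZero (n + 1) x hx) (h2.congr_rhs fun k hk => ?_) k' hk
  · rw [this]; ring
  · rw [← Umat_eq_potential, sigma_eq_neg_mul_sigma_succ n x (H.ne_zero k hk),
      zpow_add_one₀ (H.ne_zero k hk), zpow_zero]
    ring

theorem Umat_shift (H : IsUniqueAdjointSolution μ w D S X v) (n i j : ℤ) {x : ℝ × ℝ}
    (hx : x ∈ X) :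
    Umat μ w D v n x (i + 1) j
      = Umat μ w D v n x 0 j * Umat μ w D v (n + 1) x i 0 - Umat μ w D v (n + 1) x i (j + 1) := by
  have h : ∀ k' ∈ S, v n x k' j
      = Umat μ w D v n x 0 j * v (n + 1) x k' 0 + -1 * v (n + 1) x k' (j + 1) :=
    fun k' hk => by rw [H.wave_shift n j hx hk]; ring
  rw [Umat_eq_potential, ← potential_succ H.measurableSet H.domain,
    potential_congr H.measurableSet H.domain h,
    potential_add ((H.equationSolution (n + 1) 0 hx).const_mul _)
      ((H.equationSolution (n + 1) (j + 1) hx).const_mul _),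
    potential_const_mul, potential_const_mul, ← Umat_eq_potential, ← Umat_eq_potential]
  ring

theorem eventuallyEq_wave (H : IsUniqueAdjointSolution μ w D S X v) (n j : ℤ) {x : ℝ × ℝ}
    (hx : x ∈ X) {k' : ℂ} (hk : k' ∈ S) :
    (fun z => v n z k' j) =ᶠ[𝓝 x] fun z => cvec k' j * sigma n z k' -
      ∫ p in D, adjIntegrand w n z k' (fun l' => v n z l' j) p ∂μ := by
  filter_upwards [H.isOpen.mem_nhds hx] with z hz
  rw [← H.equation n j z hz k' hk]; ring

theorem differentiableAt_wave (H : IsUniqueAdjointSolution μ w D S X v) (n j : ℤ) {x : ℝ × ℝ}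
    (hx : x ∈ X) {k' : ℂ} (hk : k' ∈ S) : DifferentiableAt ℝ (fun z => v n z k' j) x := by
  obtain ⟨L, hL, -⟩ := hasFDerivAt_sigma n k' x
  exact (((hL.const_mul _).sub
    ((H.regular_eq n j k' hk).hasFDerivAt_integral H.isOpen hx)).congr_of_eventuallyEq
      (H.eventuallyEq_wave n j hx hk)).differentiableAt

theorem fderiv_wave_add_integral (H : IsUniqueAdjointSolution μ w D S X v) (n j : ℤ)
    {x : ℝ × ℝ} (hx : x ∈ X) {k' : ℂ} (hk : k' ∈ S) (e : ℝ × ℝ) :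
    fderiv ℝ (fun z => v n z k' j) x e + ∫ p in D,
      fderiv ℝ (fun z => adjIntegrand w n z k' (fun l' => v n z l' j) p) x e ∂μ
        = k' ^ j * (phase e k' * sigma n x k') := by
  obtain ⟨L, hL, hLe⟩ := hasFDerivAt_sigma n k' x
  have hR := H.regular_eq n j k' hk
  have h := ((hL.const_mul (cvec k' j)).sub
    (hR.hasFDerivAt_integral H.isOpen hx)).congr_of_eventuallyEq (H.eventuallyEq_wave n j hx hk)
  rw [h.fderiv, ← hR.fderiv_integral_apply H.isOpen hx,
    (hR.hasFDerivAt_integral H.isOpen hx).fderiv]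
  simp [hLe, cvec]

theorem fderiv_potIntegrand (H : IsUniqueAdjointSolution μ w D S X v) (n i j : ℤ) {x : ℝ × ℝ}
    (hx : x ∈ X) (e : ℝ × ℝ) {p : ℂ × ℂ} (hp : p ∈ D) :
    fderiv ℝ (fun z => potIntegrand w n z i (fun l' => v n z l' j) p) x e
      = potIntegrand w n x i (fun l' => fderiv ℝ (fun z => v n z l' j) x e) p
        + ((e.1 : ℂ) * potIntegrand w n x (i + 1) (fun l' => v n x l' j) p
          + (e.2 : ℂ) * potIntegrand w n x (i - 1) (fun l' => v n x l' j) p) := by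
  obtain ⟨h0, hS⟩ := H.domain p hp
  obtain ⟨L, hL, hLe⟩ := hasFDerivAt_rho n p.1 x
  have hv := (H.differentiableAt_wave n j hx hS).hasFDerivAt
  have := ((hL.mul_const (cvec p.1 i)).mul hv).const_mul (w p)
  refine (congrArg (fun L => L e) this.fderiv).trans ?_
  simp [hLe, potIntegrand, cvec, phase, zpow_add_one₀ h0, zpow_sub_one₀ h0]
  ring

/-- The phases add up to `(l + k') (e.1 + e.2 / (l k'))`; the first factor cancels `Ω`, and `l⁻¹`
becomes the index `-1` of the potential. -/
theorem fderiv_adjIntegrand (H : IsUniqueAdjointSolution μ w D S X v) (n j : ℤ) {x : ℝ × ℝ}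
    (hx : x ∈ X) {k' : ℂ} (hk : k' ∈ S) (e : ℝ × ℝ) {p : ℂ × ℂ} (hp : p ∈ D)
    (hpk : p.1 + k' ≠ 0) :
    fderiv ℝ (fun z => adjIntegrand w n z k' (fun l' => v n z l' j) p) x e
      = adjIntegrand w n x k' (fun l' => fderiv ℝ (fun z => v n z l' j) x e) p
        + ((e.1 : ℂ) * sigma n x k' * potIntegrand w n x 0 (fun l' => v n x l' j) p
          + (e.2 : ℂ) * k'⁻¹ * sigma n x k' *
            potIntegrand w n x (-1) (fun l' => v n x l' j) p) := by
  obtain ⟨h0, hS⟩ := H.domain p hp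
  have hk0 := H.ne_zero k' hk
  obtain ⟨L, hL, hLe⟩ := hasFDerivAt_rho n p.1 x
  obtain ⟨M, hM, hMe⟩ := hasFDerivAt_sigma n k' x
  have hv := (H.differentiableAt_wave n j hx hS).hasFDerivAt
  have := (((hL.mul_const (Omega p.1 k')).mul hM).mul hv).const_mul (w p)
  refine (congrArg (fun L => L e) this.fderiv).trans ?_
  simp [adjIntegrand, hLe, hMe, cvec, phase, potIntegrand, Omega]
  field_simp
  ring

/-- Integrability for the differentiated wave is not assumed: it is that of the differentiated
integrand minus absolutely convergent potential terms. This makes the derivative admissible for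
uniqueness. -/
theorem equationSolution_fderiv (H : IsUniqueAdjointSolution μ w D S X v) (n j : ℤ) {x : ℝ × ℝ}
    (hx : x ∈ X) (e : ℝ × ℝ) :
    EquationSolution μ w D S n x (fun k => fderiv ℝ (fun z => v n z k j) x e)
      (fun k => k ^ j * (phase e k * sigma n x k) - ((e.1 : ℂ) * sigma n x k * Umat μ w D v n x 0 j
        + (e.2 : ℂ) * k⁻¹ * sigma n x k * Umat μ w D v n x (-1) j)) := by
  have hint : ∀ i, IntegrableOn (potIntegrand w n x i (fun l' => v n x l' j)) D μ :=
    fun i => (H.regular_pot n i j).integrable hx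
  have hadj : ∀ k' ∈ S, (fun p =>
      fderiv ℝ (fun z => adjIntegrand w n z k' (fun l' => v n z l' j) p) x e
        - ((e.1 : ℂ) * sigma n x k' * potIntegrand w n x 0 (fun l' => v n x l' j) p
          + (e.2 : ℂ) * k'⁻¹ * sigma n x k' * potIntegrand w n x (-1) (fun l' => v n x l' j) p))
      =ᵐ[μ.restrict D]
        adjIntegrand w n x k' (fun l' => fderiv ℝ (fun z => v n z l' j) x e) := by
    intro k' hk
    filter_upwards [H.ae_add_ne_zero k' hk, ae_restrict_mem H.measurableSet] with p hpk hp
    rw [H.fderiv_adjIntegrand n j hx hk e hp hpk]; ring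
  have hF : ∀ k' ∈ S, IntegrableOn (fun p =>
      fderiv ℝ (fun z => adjIntegrand w n z k' (fun l' => v n z l' j) p) x e) D μ :=
    fun k' hk => ((H.regular_eq n j k' hk).integrable_fderiv H.isOpen hx).apply_continuousLinearMap e
  have hG : ∀ k' : ℂ, IntegrableOn (fun p =>
      (e.1 : ℂ) * sigma n x k' * potIntegrand w n x 0 (fun l' => v n x l' j) p
          + (e.2 : ℂ) * k'⁻¹ * sigma n x k' * potIntegrand w n x (-1) (fun l' => v n x l' j) p)
      D μ := fun k' => ((hint 0).const_mul _).add ((hint (-1)).const_mul _)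
  refine ⟨fun k' hk => ((hF k' hk).sub (hG k')).congr (hadj k' hk), fun i => ?_,
    fun k' hk => ?_⟩
  · have h := ((H.regular_pot n i j).integrable_fderiv H.isOpen hx).apply_continuousLinearMap e
    refine (h.sub (((hint (i + 1)).const_mul (e.1 : ℂ)).add
      ((hint (i - 1)).const_mul (e.2 : ℂ)))).congr ?_
    filter_upwards [ae_restrict_mem H.measurableSet] with p hp
    simp [H.fderiv_potIntegrand n i j hx e hp]
  · rw [← integral_congr_ae (hadj k' hk), integral_sub (hF k' hk) (hG k'),
      integral_add ((hint 0).const_mul _) ((hint (-1)).const_mul _), integral_const_mul,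
      integral_const_mul, ← H.fderiv_wave_add_integral n j hx hk e]
    simp only [Umat]
    ring

theorem fderiv_wave (H : IsUniqueAdjointSolution μ w D S X v) (n j : ℤ) {x : ℝ × ℝ}
    (hx : x ∈ X) {k' : ℂ} (hk : k' ∈ S) (e : ℝ × ℝ) :
    fderiv ℝ (fun z => v n z k' j) x e
      = (e.1 : ℂ) * (v n x k' (j + 1) + -Umat μ w D v n x 0 j * v n x k' 0)
        + (e.2 : ℂ) * (v n x k' (j - 1) + -Umat μ w D v n x (-1) j * v n x k' (-1)) := by
  have hs := fun j => H.equationSolution n j hx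
  refine (H.equationSolution_fderiv n j hx e).unique (H.onlyZero n x hx)
    (((((hs (j + 1)).add ((hs 0).const_mul _)).const_mul _).add
      (((hs (j - 1)).add ((hs (-1)).const_mul _)).const_mul _)).congr_rhs fun k hk => ?_) k' hk
  have h0 := H.ne_zero k hk
  simp only [phase, zpow_add_one₀ h0, zpow_sub_one₀ h0, zpow_zero, zpow_neg_one]
  ring

theorem differentiableAt_Umat (H : IsUniqueAdjointSolution μ w D S X v) (n i j : ℤ) {x : ℝ × ℝ}
    (hx : x ∈ X) : DifferentiableAt ℝ (fun z => Umat μ w D v n z i j) x :=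
  ((H.regular_pot n i j).hasFDerivAt_integral H.isOpen hx).differentiableAt

theorem fderiv_Umat (H : IsUniqueAdjointSolution μ w D S X v) (n i j : ℤ) {x : ℝ × ℝ}
    (hx : x ∈ X) (e : ℝ × ℝ) :
    fderiv ℝ (fun z => Umat μ w D v n z i j) x e
      = (e.1 : ℂ) * (Umat μ w D v n x (i + 1) j + Umat μ w D v n x i (j + 1)
          - Umat μ w D v n x i 0 * Umat μ w D v n x 0 j)
        + (e.2 : ℂ) * (Umat μ w D v n x (i - 1) j + Umat μ w D v n x i (j - 1)
          - Umat μ w D v n x i (-1) * Umat μ w D v n x (-1) j) := by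
  have hs := fun j => H.equationSolution n j hx
  have hint : ∀ i, IntegrableOn (potIntegrand w n x i (fun l' => v n x l' j)) D μ :=
    fun i => (H.regular_pot n i j).integrable hx
  have hint' : IntegrableOn (fun p =>
      (e.1 : ℂ) * potIntegrand w n x (i + 1) (fun l' => v n x l' j) p
        + (e.2 : ℂ) * potIntegrand w n x (i - 1) (fun l' => v n x l' j) p) D μ :=
    ((hint (i + 1)).const_mul _).add ((hint (i - 1)).const_mul _)
  have h1 : ∫ p in D, fderiv ℝ (fun z => potIntegrand w n z i (fun l' => v n z l' j) p) x e ∂μ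
      = potential μ w D n x i (fun l' => fderiv ℝ (fun z => v n z l' j) x e)
        + ((e.1 : ℂ) * Umat μ w D v n x (i + 1) j + (e.2 : ℂ) * Umat μ w D v n x (i - 1) j) := by
    rw [setIntegral_congr_fun H.measurableSet
      (fun p hp => H.fderiv_potIntegrand n i j hx e hp), integral_add
        ((H.equationSolution_fderiv n j hx e).integrable_pot i) hint',
      integral_add ((hint (i + 1)).const_mul _) ((hint (i - 1)).const_mul _),
      integral_const_mul, integral_const_mul]
    rfl
  have h2 := (H.regular_pot n i j).fderiv_integral_apply H.isOpen hx e
  rw [h1, potential_congr H.measurableSet H.domain fun k' hk => H.fderiv_wave n j hx hk e,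
    potential_add (((hs (j + 1)).add ((hs 0).const_mul _)).const_mul _)
      (((hs (j - 1)).add ((hs (-1)).const_mul _)).const_mul _),
    potential_const_mul, potential_const_mul, potential_add (hs (j + 1)) ((hs 0).const_mul _),
    potential_add (hs (j - 1)) ((hs (-1)).const_mul _), potential_const_mul,
    potential_const_mul] at h2
  simp only [← Umat_eq_potential] at h2
  refine h2.trans ?_
  ring

theorem contDiffOn_Umat (H : IsUniqueAdjointSolution μ w D S X v) (m : ℕ) (n i j : ℤ) :
    ContDiffOn ℝ m (fun z => Umat μ w D v n z i j) X := by
  induction m generalizing i j with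
  | zero =>
    exact contDiffOn_zero.2 fun x hx =>
      (H.differentiableAt_Umat n i j hx).continuousAt.continuousWithinAt
  | succ m ih =>
    rw [Nat.cast_add, Nat.cast_one]
    refine contDiffOn_succ_of_fderiv_apply
      (fun x hx => (H.differentiableAt_Umat n i j hx).differentiableWithinAt) (by simp)
      fun e => ?_
    have : ContDiffOn ℝ m (fun x =>
        (e.1 : ℂ) * (Umat μ w D v n x (i + 1) j + Umat μ w D v n x i (j + 1)
          - Umat μ w D v n x i 0 * Umat μ w D v n x 0 j)
        + (e.2 : ℂ) * (Umat μ w D v n x (i - 1) j + Umat μ w D v n x i (j - 1)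
          - Umat μ w D v n x i (-1) * Umat μ w D v n x (-1) j)) X :=
      (contDiffOn_const.mul (((ih _ _).add (ih _ _)).sub ((ih _ _).mul (ih _ _)))).add
        (contDiffOn_const.mul (((ih _ _).add (ih _ _)).sub ((ih _ _).mul (ih _ _))))
    -- The derivative is polynomial in entries of `U` at the same `n`, so one order of smoothness
    -- for all entries yields the next.
    refine this.congr fun x hx => ?_
    rw [fderivWithin_of_isOpen H.isOpen hx, H.fderiv_Umat n i j hx e]

end IsUniqueAdjointSolution

end Solution

/-! ### Partial derivatives and continuous logarithms. -/

section Branches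

theorem hasDerivAt_slice_fst {f : ℝ × ℝ → ℂ} {x : ℝ × ℝ} (hf : DifferentiableAt ℝ f x) :
    HasDerivAt (fun s : ℝ => f (s, x.2)) (fderiv ℝ f x (1, 0)) x.1 :=
  HasFDerivAt.comp_hasDerivAt (f := fun s : ℝ => (s, x.2)) x.1 hf.hasFDerivAt
    ((hasDerivAt_id x.1).prodMk (hasDerivAt_const x.1 x.2))

theorem hasDerivAt_slice_snd {f : ℝ × ℝ → ℂ} {x : ℝ × ℝ} (hf : DifferentiableAt ℝ f x) :
    HasDerivAt (fun s : ℝ => f (x.1, s)) (fderiv ℝ f x (0, 1)) x.2 :=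
  HasFDerivAt.comp_hasDerivAt (f := fun s : ℝ => (x.1, s)) x.2 hf.hasFDerivAt
    ((hasDerivAt_const x.2 x.1).prodMk (hasDerivAt_id x.2))

theorem d1_eq_fderiv {f : ℝ × ℝ → ℂ} {x : ℝ × ℝ} (hf : DifferentiableAt ℝ f x) :
    d1 f x = fderiv ℝ f x (1, 0) := (hasDerivAt_slice_fst hf).deriv

theorem dm1_eq_fderiv {f : ℝ × ℝ → ℂ} {x : ℝ × ℝ} (hf : DifferentiableAt ℝ f x) :
    dm1 f x = fderiv ℝ f x (0, 1) := (hasDerivAt_slice_snd hf).deriv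

/-- A continuous logarithm of a `C^m` function is `C^m`. -/
theorem contDiffOn_of_exp_eq {E : Type*} [NormedAddCommGroup E] [NormedSpace ℝ E]
    {a φ : E → ℂ} {Y : Set E} {m : WithTop ℕ∞} (hY : IsOpen Y) (ha : ContDiffOn ℝ m a Y)
    (hφ : ContinuousOn φ Y) (h : ∀ x ∈ Y, Complex.exp (φ x) = a x) : ContDiffOn ℝ m φ Y := by
  intro x hx
  have hc : ContinuousAt (fun y => (φ y - φ x).im) x :=
    Complex.continuous_im.continuousAt.comp ((hφ.continuousAt (hY.mem_nhds hx)).sub_const _)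
  have hlt : ∀ᶠ y in 𝓝 x, (φ y - φ x).im ∈ Set.Ioo (-Real.pi) Real.pi :=
    hc.eventually (Ioo_mem_nhds (by simp [Real.pi_pos]) (by simp [Real.pi_pos]))
  -- By continuity `φ y - φ x` stays in the strip where the principal logarithm inverts `exp`, and
  -- `a y / a x` is near `1`, away from the cut.
  have heq : φ =ᶠ[𝓝 x] fun y => φ x + Complex.log (a y / a x) := by
    filter_upwards [hlt, hY.mem_nhds hx] with y hy hyY
    rw [← h y hyY, ← h x hx, ← Complex.exp_sub, Complex.log_exp hy.1 hy.2.le]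
    ring
  have hax : a x ≠ 0 := by rw [← h x hx]; exact Complex.exp_ne_zero _
  have hlog : ContDiffAt ℝ m Complex.log (a x / a x) := by
    rw [div_self hax]
    exact (Complex.contDiffAt_log (by simp)).restrict_scalars ℝ
  exact ((contDiffAt_const.add (hlog.comp x
    ((ha.contDiffAt (hY.mem_nhds hx)).div_const (a x)))).congr_of_eventuallyEq
      heq).contDiffWithinAt

theorem fderiv_of_exp_eq {E : Type*} [NormedAddCommGroup E] [NormedSpace ℝ E]
    {a φ : E → ℂ} {Y : Set E} (hY : IsOpen Y) {x : E} (hx : x ∈ Y) (hφ : DifferentiableAt ℝ φ x)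
    (h : ∀ x ∈ Y, Complex.exp (φ x) = a x) (e : E) : a x * fderiv ℝ φ x e = fderiv ℝ a x e := by
  have heq : a =ᶠ[𝓝 x] fun y => Complex.exp (φ y) := by
    filter_upwards [hY.mem_nhds hx] with y hy using (h y hy).symm
  rw [heq.fderiv_eq, hφ.hasFDerivAt.cexp.fderiv, ← h x hx]
  rfl

end Branches

/-! ### The Toda equation and the adjoint Lax pair. -/

section Toda

variable {μ : Measure (ℂ × ℂ)} {w : ℂ × ℂ → ℂ} {D : Set (ℂ × ℂ)} {S : Set ℂ}
  {X : Set (ℝ × ℝ)} {v : ℤ → ℝ × ℝ → ℂ → ℤ → ℂ}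

/-- The function `1 - U_n^{(0,-1)}`, whose logarithm solves the Toda equation. -/
noncomputable def tau (μ : Measure (ℂ × ℂ)) (w : ℂ × ℂ → ℂ) (D : Set (ℂ × ℂ))
    (v : ℤ → ℝ × ℝ → ℂ → ℤ → ℂ) (n : ℤ) (x : ℝ × ℝ) : ℂ := 1 - Umat μ w D v n x 0 (-1)

namespace IsUniqueAdjointSolution

/-- The shift relation at `i = j = -1` involves only these two entries and factorises. -/
theorem tau_mul (H : IsUniqueAdjointSolution μ w D S X v) (n : ℤ) {x : ℝ × ℝ} (hx : x ∈ X) :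
    tau μ w D v n x * (1 - Umat μ w D v (n + 1) x (-1) 0) = 1 := by
  have h := H.Umat_shift n (-1) (-1) hx
  norm_num at h
  rw [tau]
  linear_combination -h

theorem tau_ne_zero (H : IsUniqueAdjointSolution μ w D S X v) (n : ℤ) {x : ℝ × ℝ} (hx : x ∈ X) :
    tau μ w D v n x ≠ 0 :=
  left_ne_zero_of_mul_eq_one (H.tau_mul n hx)

theorem contDiffOn_tau (H : IsUniqueAdjointSolution μ w D S X v) (m : ℕ) (n : ℤ) :
    ContDiffOn ℝ m (tau μ w D v n) X :=
  contDiffOn_const.sub (H.contDiffOn_Umat m n 0 (-1))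

theorem fderiv_tau (H : IsUniqueAdjointSolution μ w D S X v) (n : ℤ) {x : ℝ × ℝ} (hx : x ∈ X)
    (e : ℝ × ℝ) :
    fderiv ℝ (tau μ w D v n) x e = tau μ w D v n x *
      ((e.1 : ℂ) * (Umat μ w D v (n + 1) x 0 0 - Umat μ w D v n x 0 0)
        + (e.2 : ℂ) * (Umat μ w D v (n + 1) x (-1) (-1) - Umat μ w D v n x (-1) (-1))) := by
  have h0 : fderiv ℝ (tau μ w D v n) x e
      = -fderiv ℝ (fun z => Umat μ w D v n z 0 (-1)) x e := by
    have := (H.differentiableAt_Umat n 0 (-1) hx).hasFDerivAt.const_sub 1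
    exact congrArg (fun L => L e) this.fderiv
  have h1 := H.Umat_shift n 0 (-1) hx
  have h2 := H.Umat_shift n (-1) (-2) hx
  rw [h0, H.fderiv_Umat n 0 (-1) hx e]
  have h3 := H.tau_mul n hx
  norm_num at h1 h2 ⊢
  -- `h2` carries the factor `1 - U_{n+1}^(-1,0)` on `U_n^(0,-2)`; multiplying by `tau` removes it.
  have h4 : Umat μ w D v n x 0 (-2) = -tau μ w D v n x * Umat μ w D v (n + 1) x (-1) (-1) := by
    linear_combination (-Umat μ w D v n x 0 (-2)) * h3 + tau μ w D v n x * h2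
  rw [h4, h1]
  simp only [tau]
  ring

end IsUniqueAdjointSolution

variable {Y : Set (ℝ × ℝ)} {φ : ℤ → ℝ × ℝ → ℂ}

theorem IsLogBranch.contDiffOn (hφ : IsLogBranch (tau μ w D v) φ Y)
    (H : IsUniqueAdjointSolution μ w D S X v) (hYX : Y ⊆ X) (hY : IsOpen Y) (m : ℕ) (n : ℤ) :
    ContDiffOn ℝ m (φ n) Y :=
  contDiffOn_of_exp_eq hY ((H.contDiffOn_tau m n).mono hYX) (hφ n).1 (hφ n).2

theorem IsLogBranch.differentiableAt (hφ : IsLogBranch (tau μ w D v) φ Y)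
    (H : IsUniqueAdjointSolution μ w D S X v) (hYX : Y ⊆ X) (hY : IsOpen Y) (n : ℤ) {x : ℝ × ℝ}
    (hx : x ∈ Y) : DifferentiableAt ℝ (φ n) x :=
  ((hφ.contDiffOn H hYX hY 1 n).contDiffAt (hY.mem_nhds hx)).differentiableAt (by simp)

theorem IsLogBranch.fderiv_apply (hφ : IsLogBranch (tau μ w D v) φ Y)
    (H : IsUniqueAdjointSolution μ w D S X v) (hYX : Y ⊆ X) (hY : IsOpen Y) (n : ℤ) {x : ℝ × ℝ}
    (hx : x ∈ Y) (e : ℝ × ℝ) :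
    fderiv ℝ (φ n) x e
      = (e.1 : ℂ) * (Umat μ w D v (n + 1) x 0 0 - Umat μ w D v n x 0 0)
        + (e.2 : ℂ) * (Umat μ w D v (n + 1) x (-1) (-1) - Umat μ w D v n x (-1) (-1)) :=
  mul_left_cancel₀ (H.tau_ne_zero n (hYX hx))
    ((fderiv_of_exp_eq hY hx (hφ.differentiableAt H hYX hY n hx) (hφ n).2 e).trans
      (H.fderiv_tau n (hYX hx) e))

/-- `tau_mul` trades `1 / tau_n` for an entry at level `n + 1`, so the exponential matches the
single-level expression in `fderiv_Umat`. -/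
theorem IsLogBranch.exp_sub (hφ : IsLogBranch (tau μ w D v) φ Y)
    (H : IsUniqueAdjointSolution μ w D S X v) (hYX : Y ⊆ X) (n : ℤ) {x : ℝ × ℝ} (hx : x ∈ Y) :
    Complex.exp (φ (n + 1) x - φ n x)
      = tau μ w D v (n + 1) x * (1 - Umat μ w D v (n + 1) x (-1) 0) := by
  rw [Complex.exp_sub, (hφ n).2 x hx, (hφ (n + 1)).2 x hx,
    div_eq_iff (H.tau_ne_zero n (hYX hx))]
  linear_combination (-tau μ w D v (n + 1) x) * H.tau_mul n (hYX hx)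

theorem IsLogBranch.solvesToda (hφ : IsLogBranch (tau μ w D v) φ Y)
    (H : IsUniqueAdjointSolution μ w D S X v) (hYX : Y ⊆ X) (hY : IsOpen Y) :
    SolvesToda φ Y := by
  refine fun n => ⟨hφ.contDiffOn H hYX hY 2 n, fun x hx => ?_⟩
  have heq : dm1 (φ n) =ᶠ[𝓝 x] fun z =>
      Umat μ w D v (n + 1) z (-1) (-1) - Umat μ w D v n z (-1) (-1) := by
    filter_upwards [hY.mem_nhds hx] with z hz
    rw [dm1_eq_fderiv (hφ.differentiableAt H hYX hY n hz), hφ.fderiv_apply H hYX hY n hz]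
    simp
  have hU := fun n => H.differentiableAt_Umat n (-1) (-1) (hYX hx)
  have hd : DifferentiableAt ℝ (dm1 (φ n)) x :=
    ((hU (n + 1)).sub (hU n)).congr_of_eventuallyEq heq
  have h1 := hφ.exp_sub H hYX (n - 1) hx
  rw [sub_add_cancel] at h1
  rw [d1_eq_fderiv hd, heq.fderiv_eq, fderiv_fun_sub (hU (n + 1)) (hU n),
    sub_apply, H.fderiv_Umat _ _ _ (hYX hx), H.fderiv_Umat _ _ _ (hYX hx),
    h1, hφ.exp_sub H hYX n hx]
  norm_num [tau]
  ring

theorem infMulVec_Pmat' (φ : ℤ → ℝ × ℝ → ℂ) (x : ℝ × ℝ) (u : ℤ → ℂ) (i : ℤ) :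
    infMulVec (Pmat' φ x) u i = -d1 (φ (i - 1)) x * u i - u (i - 1) := by
  rw [infMulVec, tsum_eq_sum (s := {i, i - 1})]
  · rw [Finset.sum_pair (by omega)]
    simp [Pmat']
    ring
  · intro j hj
    simp only [Finset.mem_insert, Finset.mem_singleton, not_or] at hj
    simp [Pmat', hj.1, hj.2]

theorem infMulVec_Qmat' (φ : ℤ → ℝ × ℝ → ℂ) (x : ℝ × ℝ) (u : ℤ → ℂ) (i : ℤ) :
    infMulVec (Qmat' φ x) u i = -Complex.exp (φ i x - φ (i - 1) x) * u (i + 1) := by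
  rw [infMulVec, tsum_eq_single (i + 1)]
  · simp [Qmat', theta]
  · intro j hj
    simp [Qmat', hj]

theorem IsLogBranch.solvesAdjointLax (hφ : IsLogBranch (tau μ w D v) φ Y)
    (H : IsUniqueAdjointSolution μ w D S X v) (hYX : Y ⊆ X) (hY : IsOpen Y) {k' : ℂ}
    (hk : k' ∈ S) : SolvesAdjointLax φ (fun n x => v n x k' 0) Y := by
  intro x hx i
  have hd := H.differentiableAt_wave i 0 (hYX hx) hk
  -- The diagonal of `P'` uses `φ (i - 1)`, which links levels `i - 1` and `i`; `wave_shift` links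
  -- the same two.
  obtain ⟨n, rfl⟩ : ∃ n, i = n + 1 := ⟨i - 1, by ring⟩
  constructor
  · convert! hasDerivAt_slice_fst hd using 1
    have h := H.wave_shift n 0 (hYX hx) hk
    rw [infMulVec_Pmat', H.fderiv_wave _ _ (hYX hx) hk, add_sub_cancel_right,
      d1_eq_fderiv (hφ.differentiableAt H hYX hY _ hx), hφ.fderiv_apply H hYX hY _ hx]
    norm_num at h ⊢
    rw [h]
    ring
  · convert! hasDerivAt_slice_snd hd using 1
    -- At `j = -1` both terms on the right are component `0`, so `v_{n+1}^(-1) = -tau_{n+1}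
    -- ψ_{n+2}`.
    have h := H.wave_shift (n + 1) (-1) (hYX hx) hk
    rw [infMulVec_Qmat', H.fderiv_wave _ _ (hYX hx) hk, add_sub_cancel_right,
      hφ.exp_sub H hYX n hx]
    norm_num [tau] at h ⊢
    rw [h]
    ring

end Toda

end TodaDL

theorem theorem2
    (μ : Measure (ℂ × ℂ)) (w : ℂ × ℂ → ℂ) (hw : Measurable w)
    (D : Set (ℂ × ℂ)) (hD : MeasurableSet D) (S : Set ℂ)
    (hDS : ∀ p ∈ D, p.1 ≠ 0 ∧ p.2 ∈ S)
    (hS0 : ∀ k' ∈ S, k' ≠ 0)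
    (hSD : ∀ k' ∈ S, ∀ᵐ p ∂(μ.restrict D), p.1 + k' ≠ 0)
    (X : Set (ℝ × ℝ)) (hX : IsOpen X)
    (huniq : ∀ n : ℤ, ∀ x ∈ X, HomogeneousOnlyZero μ w D S n x)
    (v : ℤ → ℝ × ℝ → ℂ → ℤ → ℂ) (hv : IsAdjointSolution μ w D S X v) :
    (∀ n : ℤ, ∀ x ∈ X, 1 - Umat μ w D v n x 0 (-1) ≠ 0) ∧
    (∀ Y : Set (ℝ × ℝ), Y ⊆ X → IsOpen Y → IsSimplyConnected Y →
      ∃ φ : ℤ → ℝ × ℝ → ℂ,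
        IsLogBranch (fun n x => 1 - Umat μ w D v n x 0 (-1)) φ Y) ∧
    (∀ Y : Set (ℝ × ℝ), Y ⊆ X → IsOpen Y → ∀ φ : ℤ → ℝ × ℝ → ℂ,
      IsLogBranch (fun n x => 1 - Umat μ w D v n x 0 (-1)) φ Y →
        SolvesToda φ Y ∧
        ∀ k' ∈ S, SolvesAdjointLax φ (fun n x => v n x k' 0) Y) := by
  have H : IsUniqueAdjointSolution μ w D S X v :=
    { hv with
      measurableSet := hD
      domain := hDS
      ne_zero := hS0
      ae_add_ne_zero := hSD
      isOpen := hX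
      onlyZero := huniq }
  refine ⟨fun n x hx => H.tau_ne_zero n hx, fun Y hYX hY hYs => ?_, fun Y hYX hY φ hφ =>
    ⟨IsLogBranch.solvesToda hφ H hYX hY, fun k' hk => IsLogBranch.solvesAdjointLax hφ H hYX hY hk⟩⟩
  choose φ hφ using fun n : ℤ => Complex.exists_continuousOn_eqOn_exp_comp hYs hY
    (((H.contDiffOn_tau 1 n).mono hYX).continuousOn)
    (by rintro ⟨x, hx, h0⟩; exact H.tau_ne_zero n (hYX hx) h0)
  exact ⟨φ, fun n => ⟨(hφ n).1, fun x hx => (hφ n).2 hx⟩⟩
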